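/- Let $(R,\mathfrak m)$ be a Gorenstein local ring, that is, a commutative Noetherian local ring with finite injective dimension as a module over itself. Let $n\ge 0$, let $x_1,\dots,x_n$ be an $R$-regular sequence, and let $y\in\mathfrak m$ be such that the ideal $I=(x_1,\dots,x_n,y)$ of $R$ has height $n$. Then the following conditions are equivalent: (i) $\operatorname{Ext}^n_R(R/I,R)\cong R/I$ as $R$-modules; (ii) $I$ is a Gorenstein ideal, that is, the factor ring $R/I$ is a Gorenstein local ring. -/

import Mathlib

open CategoryTheory

universe u

/-- A Gorenstein local ring: a Noetherian local commutative ring of finite injective dimension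
as a module over itself. -/
class IsGorensteinLocalRing (R : Type u) [CommRing R] : Prop
    extends IsLocalRing R, IsNoetherianRing R where
  exists_hasInjectiveDimensionLE_self :
    ∃ d : ℕ, HasInjectiveDimensionLE (ModuleCat.of R R) d

/-- A Gorenstein ideal: an ideal `I` whose factor ring `R ⧸ I` is a Gorenstein local ring. -/
def Ideal.IsGorenstein {R : Type u} [CommRing R] (I : Ideal R) : Prop :=
  IsGorensteinLocalRing (R ⧸ I)

/-! Put J = (x_1, ..., x_n) and S = R/J. Factoring out a regular element of the maximal ideal
preserves the Gorenstein property (`IsSMulRegular.hasInjectiveDimensionLE_quotient`), so S is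
Gorenstein. Rees's isomorphism Ext^n(R/I, R) ≅ Hom(R/I, S), followed by evaluation at 1, identifies
the Ext module with Ann_S(y). It is isomorphic to R/I = S/(y) exactly when some z satisfies Ann(y) =
(z) and Ann(z) = (y), that is, when y belongs to a pair of exact zero divisors.

It remains to see that such a z exists if and only if S/(y) is Gorenstein. Given z, the periodic
resolution with maps y, z, y, ... yields Ext^i(S/(y), S) = 0 for i > 0, and S/(y) ≅ (z) is the
y-torsion of S; taking y-torsion in an injective resolution of S bounds the injective dimension of
S/(y). Conversely, height n forces y to be a zero divisor on S. Factor out elements regular on both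
S and S/(y) until one of them has depth zero. Then both are self-injective, socles and double
annihilators produce z (`IsLocalRing.exists_isExactZeroDivisorPair_of_injective`), and Nakayama
lifts it back (`IsExactZeroDivisorPair.exists_of_quotient`). -/

open Abelian

/-! ### Vanishing of Ext along short exact sequences. -/

namespace CategoryTheory.ShortComplex.ShortExact

variable {C : Type*} [Category* C] [Abelian C] [HasExt C] {S : ShortComplex C}

lemma subsingleton_ext_covariant₃ (hS : S.ShortExact) (X : C) (i : ℕ)
    (h₂ : Subsingleton (Ext X S.X₂ i)) (h₁ : Subsingleton (Ext X S.X₁ (i + 1))) :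
    Subsingleton (Ext X S.X₃ i) := by
  refine subsingleton_of_forall_eq 0 fun e ↦ ?_
  obtain ⟨e', rfl⟩ := Ext.covariant_sequence_exact₃ X hS e rfl (Subsingleton.elim _ _)
  rw [Subsingleton.elim e' 0, Ext.zero_comp]

lemma subsingleton_ext_contravariant₁ (hS : S.ShortExact) (Y : C) (i : ℕ)
    (h₂ : Subsingleton (Ext S.X₂ Y i)) (h₃ : Subsingleton (Ext S.X₃ Y (i + 1))) :
    Subsingleton (Ext S.X₁ Y i) := by
  refine subsingleton_of_forall_eq 0 fun e ↦ ?_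
  obtain ⟨e', rfl⟩ := Ext.contravariant_sequence_exact₁ hS Y e (add_comm 1 i)
    (Subsingleton.elim _ _)
  rw [Subsingleton.elim e' 0, Ext.comp_zero]

lemma subsingleton_ext_contravariant₂ (hS : S.ShortExact) (Y : C) (i : ℕ)
    (h₁ : Subsingleton (Ext S.X₁ Y i)) (h₃ : Subsingleton (Ext S.X₃ Y i)) :
    Subsingleton (Ext S.X₂ Y i) := by
  refine subsingleton_of_forall_eq 0 fun e ↦ ?_
  obtain ⟨e', rfl⟩ := Ext.contravariant_sequence_exact₂ hS Y e (Subsingleton.elim _ _)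
  rw [Subsingleton.elim e' 0, Ext.comp_zero]

lemma subsingleton_ext_contravariant₃ (hS : S.ShortExact) (Y : C) (i : ℕ)
    (h₁ : Subsingleton (Ext S.X₁ Y i)) (h₂ : Subsingleton (Ext S.X₂ Y (i + 1))) :
    Subsingleton (Ext S.X₃ Y (i + 1)) := by
  refine subsingleton_of_forall_eq 0 fun e ↦ ?_
  obtain ⟨e', rfl⟩ := Ext.contravariant_sequence_exact₃ hS Y e (Subsingleton.elim _ _)
    (add_comm 1 i)
  rw [Subsingleton.elim e' 0, Ext.comp_zero]

end CategoryTheory.ShortComplex.ShortExact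

/-! ### Injective dimension tested on cyclic modules. -/

section

variable {R : Type u} [CommRing R]

lemma CategoryTheory.Abelian.Ext.subsingleton_of_linearEquiv {M M' : Type u} [AddCommGroup M]
    [Module R M] [AddCommGroup M'] [Module R M'] (e : M ≃ₗ[R] M') (N : ModuleCat.{u} R) (i : ℕ)
    (h : Subsingleton (Ext (ModuleCat.of R M) N i)) :
    Subsingleton (Ext (ModuleCat.of R M') N i) := by
  refine subsingleton_of_forall_eq 0 fun x ↦ ?_
  have : (Ext.mk₀ e.toModuleIso.inv).comp
      ((Ext.mk₀ e.toModuleIso.hom).comp x (zero_add i)) (zero_add i) = x := by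
    rw [Ext.mk₀_comp_mk₀_assoc, Iso.inv_hom_id, Ext.mk₀_id_comp]
  rw [← this, Subsingleton.elim ((Ext.mk₀ e.toModuleIso.hom).comp x (zero_add i)) 0,
    Ext.comp_zero]

/-- A short exact sequence of modules, as a short exact sequence in the category of modules. -/
lemma Function.Exact.shortExact_moduleCat {M₁ M₂ M₃ : Type u} [AddCommGroup M₁] [AddCommGroup M₂]
    [AddCommGroup M₃] [Module R M₁] [Module R M₂] [Module R M₃] {f : M₁ →ₗ[R] M₂}
    {g : M₂ →ₗ[R] M₃} (h : Function.Exact f g) (hf : Function.Injective f)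
    (hg : Function.Surjective g) :
    (ModuleCat.shortComplexOfCompEqZero f g h.linearMap_comp_eq_zero).ShortExact :=
  ModuleCat.shortComplex_shortExact _ h hf hg

/-- Every module embeds in an injective module. -/
lemma ModuleCat.exists_injective_exact (N : Type u) [AddCommGroup N] [Module R N] :
    ∃ (E Q : ModuleCat.{u} R) (f : N →ₗ[R] E) (g : E →ₗ[R] Q), Module.Injective R E ∧
      Function.Exact f g ∧ Function.Injective f ∧ Function.Surjective g := by
  let ⟨E, _, f, _⟩ := EnoughInjectives.presentation (ModuleCat.of R N)
  exact ⟨E, ModuleCat.of R (E ⧸ f.hom.range), f.hom, f.hom.range.mkQ,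
    Module.injective_module_of_injective_object R E, f.hom.exact_map_mkQ_range,
    (ModuleCat.mono_iff_injective f).mp ‹_›, Submodule.mkQ_surjective _⟩

/-- Baer's criterion: the obstruction to extending a map J → N to R lies in Ext^1(R/J, N). -/
lemma Module.Injective.of_subsingleton_ext_one (N : Type u) [AddCommGroup N] [Module R N]
    (h : ∀ J : Ideal R, Subsingleton (Ext (ModuleCat.of R (R ⧸ J)) (ModuleCat.of R N) 1)) :
    Module.Injective R N := by
  refine Module.Baer.injective fun J g ↦ ?_
  have hex : Function.Exact J.subtype (Submodule.mkQ J) := LinearMap.exact_subtype_mkQ J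
  have hS := hex.shortExact_moduleCat J.subtype_injective J.mkQ_surjective
  have := h J
  obtain ⟨φ, hφ⟩ := Ext.contravariant_sequence_exact₁ hS (ModuleCat.of R N)
    (Ext.mk₀ (ModuleCat.ofHom g)) (add_comm 1 0) (by
      exact Subsingleton.elim (α := Ext (ModuleCat.of R (R ⧸ J)) (ModuleCat.of R N) 1) _ _)
  obtain ⟨φ, rfl⟩ := Ext.homEquiv₀.symm.surjective φ
  rw [Ext.homEquiv₀_symm_apply, Ext.mk₀_comp_mk₀] at hφ
  have key := Ext.homEquiv₀.symm.injective hφ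
  refine ⟨φ.hom, fun x hx ↦ ?_⟩
  exact congr($(key).hom ⟨x, hx⟩)

/-- Dimension shifting along 0 → N → E → Q → 0 with E injective reduces to Baer's criterion. -/
lemma ModuleCat.hasInjectiveDimensionLE_of_subsingleton_ext_quotient (N : Type u)
    [AddCommGroup N] [Module R N] (d : ℕ)
    (h : ∀ J : Ideal R, Subsingleton (Ext (ModuleCat.of R (R ⧸ J)) (ModuleCat.of R N) (d + 1))) :
    HasInjectiveDimensionLE (ModuleCat.of R N) d := by
  induction d generalizing N with
  | zero =>
    have := Module.Injective.of_subsingleton_ext_one N h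
    have := Module.injective_object_of_injective_module R N
    exact injective_iff_hasInjectiveDimensionLT_one.mp this
  | succ d ih =>
    obtain ⟨E, Q, f, g, hE, hex, hf, hg⟩ := ModuleCat.exists_injective_exact (R := R) N
    have hS := hex.shortExact_moduleCat hf hg
    have : Injective E := Module.injective_object_of_injective_module R E
    refine (hS.hasInjectiveDimensionLT_X₃_iff d this).mp (ih Q fun J ↦ ?_)
    exact hS.subsingleton_ext_covariant₃ _ _
      (HasInjectiveDimensionLT.subsingleton E 1 (d + 1) (by lia) _) (h J)

end

/-! ### Finite injective dimension and depth zero imply self-injectivity. -/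

section

variable {R : Type u} [CommRing R]

/-- The short exact sequence `0 → R ⧸ I → R → R ⧸ (z) → 0` for `I` the annihilator of `z`. -/
lemma Ideal.exists_exact_quotient_span_singleton {I : Ideal R} {z : R}
    (hz : ∀ a, a ∈ I ↔ z * a = 0) :
    ∃ f : (R ⧸ I) →ₗ[R] R, f (Ideal.Quotient.mk I 1) = z ∧ Function.Injective f ∧
      Function.Exact f (Submodule.mkQ (Ideal.span {z})) := by
  have hI : I = LinearMap.ker (LinearMap.toSpanSingleton R R z) := by
    ext a; simp [hz, mul_comm]
  refine ⟨I.liftQ (LinearMap.toSpanSingleton R R z) hI.le, ?_, ?_, ?_⟩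
  · exact (Submodule.liftQ_apply _ _ _).trans (by simp)
  · exact LinearMap.ker_eq_bot.mp (Submodule.ker_liftQ_eq_bot _ _ _ hI.ge)
  · rw [LinearMap.exact_iff, Submodule.ker_mkQ, Submodule.range_liftQ]
    ext a; simp [Submodule.mem_span_singleton, eq_comm]

instance ModuleCat.projective_of_self : Projective (ModuleCat.of R R) :=
  ModuleCat.projective_of_free (Module.Basis.singleton Unit R)

lemma CategoryTheory.Abelian.Ext.subsingleton_of_self (N : ModuleCat.{u} R) (i : ℕ) :
    Subsingleton (Ext (ModuleCat.of R R) N (i + 1)) :=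
  subsingleton_of_forall_eq 0 fun e ↦ e.eq_zero_of_projective

lemma CategoryTheory.Abelian.Ext.mk₀_smul_id_comp {M N : ModuleCat.{u} R} {i : ℕ} (a : R)
    (x : Ext M N i) : (Ext.mk₀ (a • 𝟙 M)).comp x (zero_add i) = a • x := by
  rw [Ext.mk₀_smul, Ext.smul_comp, Ext.mk₀_id_comp]

variable [IsNoetherianRing R] [IsLocalRing R]

open IsLocalRing Pointwise in
/-- If the residue field embeds in `R`, a positive bound on the injective dimension of `R` can be
lowered. -/
lemma IsLocalRing.hasInjectiveDimensionLE_self_of_succ {u : R} (hu : u ≠ 0)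
    (hmu : ∀ a ∈ maximalIdeal R, a * u = 0) (d : ℕ)
    [hd : HasInjectiveDimensionLE (ModuleCat.of R R) (d + 1)] :
    HasInjectiveDimensionLE (ModuleCat.of R R) d := by
  have hvan (M : ModuleCat.{u} R) : Subsingleton (Ext M (ModuleCat.of R R) (d + 2)) :=
    HasInjectiveDimensionLT.subsingleton _ (d + 2) (d + 2) le_rfl M
  -- As 1 ↦ u embeds the residue field k in R, Ext^{d+1}(k, R) lies between Ext^{d+1}(R, R) = 0 and
  -- Ext^{d+2}(R/(u), R) = 0.
  have hk : Subsingleton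
      (Ext (ModuleCat.of R (R ⧸ maximalIdeal R)) (ModuleCat.of R R) (d + 1)) := by
    obtain ⟨f, -, hf, hex⟩ := Ideal.exists_exact_quotient_span_singleton (I := maximalIdeal R)
      (z := u) fun a ↦ ⟨fun ha ↦ mul_comm u a ▸ hmu a ha, fun ha ↦ by
        by_contra h
        exact hu (((notMem_maximalIdeal.mp h).mul_left_eq_zero).mp ha)⟩
    exact (hex.shortExact_moduleCat hf (Submodule.mkQ_surjective _)).subsingleton_ext_contravariant₁
      _ _ (Ext.subsingleton_of_self _ d) (hvan _)
  suffices h : ∀ (N : Type u) [AddCommGroup N] [Module R N] (_ : Module.Finite R N),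
      Subsingleton (Ext (ModuleCat.of R N) (ModuleCat.of R R) (d + 1)) from
    ModuleCat.hasInjectiveDimensionLE_of_subsingleton_ext_quotient _ d fun J ↦ h _ inferInstance
  intro N _ _ hfin
  induction hfin using IsNoetherianRing.induction_on_isQuotientEquivQuotientPrime R with
  | subsingleton N =>
    have : Limits.IsZero (ModuleCat.of R N) := ModuleCat.isZero_of_subsingleton _
    refine subsingleton_of_forall_eq 0 fun e ↦ ?_
    rw [← Ext.mk₀_id_comp e, this.eq_zero_of_src (𝟙 _), Ext.mk₀_zero, Ext.zero_comp]
  | exact N₁ N₂ N₃ f g hf hg hex h₁ h₃ =>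
    exact (hex.shortExact_moduleCat hf hg).subsingleton_ext_contravariant₂ _ _ h₁ h₃
  | quotient N p e =>
    refine Ext.subsingleton_of_linearEquiv e.symm _ _ ?_
    obtain hp | hp := eq_or_ne p.1 (maximalIdeal R)
    · rwa [hp]
    -- Some a in the maximal ideal is regular on R/p. Since Ext^{d+2} vanishes, a acts surjectively
    -- on the finitely generated module Ext^{d+1}(R/p, R), which is then zero by Nakayama.
    obtain ⟨a, ha, hap⟩ := SetLike.exists_of_lt (lt_of_le_of_ne (le_maximalIdeal p.2.ne_top) hp)
    have hreg : IsSMulRegular (R ⧸ p.1) a := by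
      rw [isSMulRegular_iff_right_eq_zero_of_smul]
      intro x
      obtain ⟨x, rfl⟩ := Ideal.Quotient.mk_surjective x
      intro h
      have : Ideal.Quotient.mk p.1 (a * x) = 0 := h
      rw [Ideal.Quotient.eq_zero_iff_mem] at this ⊢
      exact (p.2.mem_or_mem this).resolve_left hap
    have hS := IsSMulRegular.smulShortComplex_shortExact (M := ModuleCat.of R (R ⧸ p.1)) hreg
    have hsurj (x : Ext (ModuleCat.of R (R ⧸ p.1)) (ModuleCat.of R R) (d + 1)) :
        ∃ x', a • x' = x := by
      have := hvan (ModuleCat.smulShortComplex (ModuleCat.of R (R ⧸ p.1)) a).X₃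
      obtain ⟨x', hx'⟩ := Ext.contravariant_sequence_exact₁ hS _ x (add_comm 1 (d + 1))
        (Subsingleton.elim _ _)
      exact ⟨x', (Ext.mk₀_smul_id_comp a x').symm.trans hx'⟩
    refine (Submodule.subsingleton_iff R).mp (subsingleton_of_bot_eq_top (Eq.symm ?_))
    refine Submodule.eq_bot_of_le_smul_of_le_jacobson_bot (maximalIdeal R) ⊤ Module.Finite.fg_top
      (fun x _ ↦ ?_) (IsLocalRing.maximalIdeal_le_jacobson ⊥)
    obtain ⟨x', rfl⟩ := hsurj x
    exact Submodule.smul_mem_smul ha trivial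

open IsLocalRing in
lemma IsLocalRing.injective_self_of_hasInjectiveDimensionLE {u : R} (hu : u ≠ 0)
    (hmu : ∀ a ∈ maximalIdeal R, a * u = 0) (d : ℕ)
    (hd : HasInjectiveDimensionLE (ModuleCat.of R R) d) : Module.Injective R R := by
  induction d with
  | zero =>
    have := injective_iff_hasInjectiveDimensionLT_one.mpr hd
    exact Module.injective_module_of_injective_object R R
  | succ d ih => exact ih (hasInjectiveDimensionLE_self_of_succ hu hmu d)

end

/-! ### Change of rings: J-torsion and injective dimension over R/J. -/

section

variable {R : Type u} [CommRing R]

/-- Homomorphisms out of `R ⧸ J` lift along a surjection whose kernel has no first `Ext`. -/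
lemma Submodule.exists_torsionBySet_lift {N E Q : Type u} [AddCommGroup N] [AddCommGroup E]
    [AddCommGroup Q] [Module R N] [Module R E] [Module R Q] {f : N →ₗ[R] E} {g : E →ₗ[R] Q}
    (hex : Function.Exact f g) (hf : Function.Injective f) (hg : Function.Surjective g)
    (J : Ideal R)
    (h : Subsingleton (Ext (ModuleCat.of R (R ⧸ J)) (ModuleCat.of R N) 1))
    (q : Submodule.torsionBySet R Q (J : Set R)) :
    ∃ e : Submodule.torsionBySet R E (J : Set R), g e = q := by
  have hq (a : R) (ha : a ∈ J) : a • (q : Q) = 0 :=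
    (Submodule.mem_torsionBySet_iff _ _).mp q.2 ⟨a, ha⟩
  let φ : (R ⧸ J) →ₗ[R] Q := J.liftQ (LinearMap.toSpanSingleton R Q q) fun a ha ↦ by
    simpa using hq a ha
  have hφ : φ (Submodule.Quotient.mk 1) = q :=
    (Submodule.liftQ_apply _ _ _).trans (by simp)
  have hS := hex.shortExact_moduleCat hf hg
  obtain ⟨ψ, hψ⟩ := Ext.covariant_sequence_exact₃ (ModuleCat.of R (R ⧸ J)) hS
    (Ext.mk₀ (ModuleCat.ofHom φ)) (zero_add 1) (by
      exact Subsingleton.elim (α := Ext (ModuleCat.of R (R ⧸ J)) (ModuleCat.of R N) 1) _ _)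
  obtain ⟨ψ, rfl⟩ := Ext.homEquiv₀.symm.surjective ψ
  rw [Ext.homEquiv₀_symm_apply, Ext.mk₀_comp_mk₀] at hψ
  have key := Ext.homEquiv₀.symm.injective hψ
  refine ⟨⟨ψ.hom (Submodule.Quotient.mk 1), ?_⟩, ?_⟩
  · rw [Submodule.mem_torsionBySet_iff]
    rintro ⟨a, ha⟩
    have h0 : (a • Submodule.Quotient.mk 1 : R ⧸ J) = 0 := by
      rw [← Submodule.Quotient.mk_smul, Submodule.Quotient.mk_eq_zero]
      simpa using ha
    exact (map_smul ψ.hom a _).symm.trans ((congrArg ψ.hom h0).trans (map_zero _))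
  · exact (congr($(key).hom (Submodule.Quotient.mk 1))).trans hφ

/-- The `J`-torsion of an injective module is injective over `R ⧸ J`. -/
lemma Module.Injective.of_injective_torsionBySet (J : Ideal R) {E : Type u} [AddCommGroup E]
    [Module R E] [Module.Injective R E] {P : Type u} [AddCommGroup P] [Module R P]
    [Module (R ⧸ J) P] [IsScalarTower R (R ⧸ J) P] (j : P →ₗ[R] E) (hj : Function.Injective j)
    (hrange : ∀ e : E, (∀ a ∈ J, a • e = 0) → e ∈ LinearMap.range j) :
    Module.Injective (R ⧸ J) P := by
  refine Module.Baer.injective fun K g ↦ ?_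
  let π : R →ₗ[R] (R ⧸ J) := J.mkQ
  let g₀ : (K.restrictScalars R).comap π →ₗ[R] E :=
    j ∘ₗ g.restrictScalars R ∘ₗ π.restrict (q := K.restrictScalars R) fun x hx ↦ hx
  obtain ⟨h, hh⟩ := Module.Baer.iff_injective.mpr ‹Module.Injective R E› _ g₀
  -- The extension `h` agrees with `g₀` on J, where `g₀` vanishes; so `h 1` is J-torsion and comes
  -- from P.
  obtain ⟨p, hp⟩ := hrange (h 1) fun a ha ↦ by
    have h0 : (π a : R ⧸ J) = 0 := (Submodule.Quotient.mk_eq_zero J).mpr ha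
    have hmem : a ∈ (K.restrictScalars R).comap π := by
      rw [Submodule.mem_comap, h0]; exact zero_mem _
    rw [← map_smul, smul_eq_mul, mul_one, hh a hmem]
    have : π.restrict (q := K.restrictScalars R) (fun x hx ↦ hx)
        (⟨a, hmem⟩ : (K.restrictScalars R).comap π) = 0 := Subtype.ext h0
    exact (congrArg (fun t : K ↦ j (g t)) this).trans
      ((congrArg j (map_zero g)).trans (map_zero j))
  refine ⟨LinearMap.toSpanSingleton _ _ p, fun x hx ↦ hj ?_⟩
  obtain ⟨a, rfl⟩ := Submodule.mkQ_surjective J x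
  have ha := hh a hx
  calc j (π a • p) = j (a • p) := by
        congr 1
        exact algebraMap_smul (R ⧸ J) a p
    _ = h a := by rw [map_smul, hp, ← map_smul, smul_eq_mul, mul_one]
    _ = _ := ha

/-- If the higher `Ext`s from `R ⧸ J` to `N` vanish, then the injective dimension over `R ⧸ J` of
the `J`-torsion of `N` is at most that of `N`. -/
lemma ModuleCat.hasInjectiveDimensionLE_torsionBySet (J : Ideal R) (d : ℕ) {N : Type u}
    [AddCommGroup N] [Module R N] [hd : HasInjectiveDimensionLE (ModuleCat.of R N) d]
    (hN : ∀ i : ℕ, Subsingleton (Ext (ModuleCat.of R (R ⧸ J)) (ModuleCat.of R N) (i + 1)))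
    {P : Type u} [AddCommGroup P] [Module R P] [Module (R ⧸ J) P] [IsScalarTower R (R ⧸ J) P]
    (j : P →ₗ[R] N) (hj : Function.Injective j)
    (hrange : ∀ e : N, (∀ a ∈ J, a • e = 0) → e ∈ LinearMap.range j) :
    HasInjectiveDimensionLE (ModuleCat.of (R ⧸ J) P) d := by
  induction d generalizing N P with
  | zero =>
    have := injective_iff_hasInjectiveDimensionLT_one.mpr hd
    have := Module.injective_module_of_injective_object R N
    have := Module.Injective.of_injective_torsionBySet J j hj hrange
    exact injective_iff_hasInjectiveDimensionLT_one.mp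
      (Module.injective_object_of_injective_module (R ⧸ J) P)
  | succ d ih =>
    obtain ⟨E, Q, f, g, hE, hex, hf, hg⟩ := ModuleCat.exists_injective_exact (R := R) N
    have hS := hex.shortExact_moduleCat hf hg
    have : Injective E := Module.injective_object_of_injective_module R E
    have hQ : HasInjectiveDimensionLE Q d := (hS.hasInjectiveDimensionLT_X₃_iff d this).mpr hd
    have ihQ := ih (N := Q) (fun i ↦ hS.subsingleton_ext_covariant₃ _ _
        (HasInjectiveDimensionLT.subsingleton E 1 (i + 1) (by lia) _) (hN (i + 1)))
      (P := Submodule.torsionBySet R Q (J : Set R)) (Submodule.subtype _)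
      (Submodule.subtype_injective _) fun e he ↦ by
        rw [Submodule.range_subtype, Submodule.mem_torsionBySet_iff]
        exact fun a ↦ he a a.2
    have hEinj := Module.Injective.of_injective_torsionBySet J
      (P := Submodule.torsionBySet R E (J : Set R)) (Submodule.subtype _)
      (Submodule.subtype_injective _) fun e he ↦ by
        rw [Submodule.range_subtype, Submodule.mem_torsionBySet_iff]
        exact fun a ↦ he a a.2
    have hEinj' := Module.injective_object_of_injective_module (R ⧸ J)
      (Submodule.torsionBySet R E (J : Set R))
    have hsurj : Function.Surjective (algebraMap R (R ⧸ J)) := Ideal.Quotient.mk_surjective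
    have hjJ (p : P) (a : R) (ha : a ∈ J) : a • p = 0 := by
      rw [← algebraMap_smul (R ⧸ J) a p,
        show algebraMap R (R ⧸ J) a = 0 from Ideal.Quotient.eq_zero_iff_mem.mpr ha, zero_smul]
    let f' : P →ₗ[R] Submodule.torsionBySet R E (J : Set R) := (f ∘ₗ j).codRestrict _ fun p ↦ by
      rw [Submodule.mem_torsionBySet_iff]
      rintro ⟨a, ha⟩
      rw [← map_smul, hjJ p a ha, map_zero]
    let g' : Submodule.torsionBySet R E (J : Set R) →ₗ[R] Submodule.torsionBySet R Q (J : Set R) :=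
      g.restrict fun e he ↦ by
        rw [Submodule.mem_torsionBySet_iff] at he ⊢
        exact fun a ↦ by rw [← map_smul, he a, map_zero]
    have hex' : Function.Exact (f'.extendScalarsOfSurjective hsurj)
        (g'.extendScalarsOfSurjective hsurj) := by
      intro e
      change g' e = 0 ↔ ∃ p, f' p = e
      constructor
      · intro h
        obtain ⟨n, hn⟩ := (hex e).mp congr(($h : Q))
        obtain ⟨p, rfl⟩ := hrange n fun a ha ↦ hf (by
          rw [map_smul, hn, map_zero]
          exact (Submodule.mem_torsionBySet_iff _ _).mp e.2 ⟨a, ha⟩)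
        exact ⟨p, Subtype.ext hn⟩
      · rintro ⟨p, rfl⟩
        exact Subtype.ext (hex.apply_apply_eq_zero (j p))
    -- J-torsion is left exact; surjectivity onto the torsion of Q is where Ext^1(R/J, N) = 0 is
    -- needed.
    have hS' := hex'.shortExact_moduleCat
      (fun p q h ↦ hj (hf congr(($h : E))))
      (fun q ↦ (Submodule.exists_torsionBySet_lift hex hf hg J (hN 0) q).imp
        fun e he ↦ Subtype.ext he)
    exact (hS'.hasInjectiveDimensionLT_X₃_iff d hEinj').mp ihQ

end

/-! ### Quotients by exact zero divisors and by regular elements. -/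

section

variable {R : Type u} [CommRing R]

/-- The elements `y` and `z` form a pair of exact zero divisors: the annihilator of each is the
ideal generated by the other. -/
def IsExactZeroDivisorPair (y z : R) : Prop :=
  ∀ a : R, (y * a = 0 ↔ z ∣ a) ∧ (z * a = 0 ↔ y ∣ a)

lemma IsExactZeroDivisorPair.symm {y z : R} (h : IsExactZeroDivisorPair y z) :
    IsExactZeroDivisorPair z y := fun a ↦ (h a).symm

lemma IsExactZeroDivisorPair.exists_exact {y z : R} (h : IsExactZeroDivisorPair y z) :
    ∃ f : (R ⧸ Ideal.span {y}) →ₗ[R] R, f (Ideal.Quotient.mk _ 1) = z ∧ Function.Injective f ∧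
      Function.Exact f (Submodule.mkQ (Ideal.span {z})) :=
  Ideal.exists_exact_quotient_span_singleton fun a ↦ by
    rw [Ideal.mem_span_singleton, (h a).2]

/-- The sequence 0 → R/(z) → R → R/(y) → 0, with 1 ↦ y, shifts degrees while exchanging y and z. In
degree one, a map φ : R/(z) → R has φ(1) in Ann(z) = (y), so it extends to R and its connecting
class is zero. -/
lemma IsExactZeroDivisorPair.subsingleton_ext {y z : R} (h : IsExactZeroDivisorPair y z) (i : ℕ) :
    Subsingleton (Ext (ModuleCat.of R (R ⧸ Ideal.span {y})) (ModuleCat.of R R) (i + 1)) := by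
  induction i generalizing y z with
  | zero =>
    obtain ⟨f, hf1, hf, hex⟩ := h.symm.exists_exact
    have hS := hex.shortExact_moduleCat hf (Submodule.mkQ_surjective _)
    refine subsingleton_of_forall_eq 0 fun e ↦ ?_
    have := Ext.subsingleton_of_self (ModuleCat.of R R) 0
    obtain ⟨φ, rfl⟩ := Ext.contravariant_sequence_exact₃ hS _ e
      (Subsingleton.elim (α := Ext (ModuleCat.of R R) (ModuleCat.of R R) 1) _ _) (add_comm 1 0)
    obtain ⟨φ, rfl⟩ := Ext.homEquiv₀.symm.surjective φ
    have hz : z * φ.hom (Ideal.Quotient.mk _ 1) = 0 := by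
      rw [← smul_eq_mul, ← map_smul]
      have : (z • Ideal.Quotient.mk (Ideal.span {z}) 1 : R ⧸ Ideal.span {z}) = 0 := by
        rw [← Ideal.Quotient.mkₐ_eq_mk R, ← map_smul, Ideal.Quotient.mkₐ_eq_mk]
        simp
      exact (congrArg φ.hom this).trans (map_zero _)
    obtain ⟨c, hc⟩ := (h _).2.mp hz
    have key : φ = ModuleCat.ofHom f ≫ ModuleCat.ofHom (LinearMap.toSpanSingleton R R c) := by
      refine ModuleCat.hom_ext (LinearMap.ext fun t ↦ ?_)
      obtain ⟨t, rfl⟩ := Submodule.mkQ_surjective _ t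
      have ht : (Submodule.mkQ (Ideal.span {z}) t : R ⧸ Ideal.span {z}) =
          t • Ideal.Quotient.mk (Ideal.span {z}) 1 :=
        (congrArg _ (mul_one t).symm).trans (map_smul (Submodule.mkQ (Ideal.span {z})) t 1)
      have h1 : φ.hom (Submodule.mkQ (Ideal.span {z}) t) = t * (y * c) := by
        rw [ht, map_smul, hc, smul_eq_mul]
      have h2 : f (Submodule.mkQ (Ideal.span {z}) t) = t * y := by
        rw [ht, map_smul, hf1, smul_eq_mul]
      refine h1.trans ?_
      change _ = f _ • c
      rw [h2, smul_eq_mul, mul_assoc]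
    rw [Ext.homEquiv₀_symm_apply, key, ← Ext.mk₀_comp_mk₀]
    exact hS.extClass_comp_assoc (Ext.mk₀ (ModuleCat.ofHom (LinearMap.toSpanSingleton R R c)))
  | succ i ih =>
    obtain ⟨f, -, hf, hex⟩ := h.symm.exists_exact
    exact (hex.shortExact_moduleCat hf (Submodule.mkQ_surjective _)).subsingleton_ext_contravariant₃
      _ _ (ih h.symm) (Ext.subsingleton_of_self _ _)

/-- The map 1 ↦ z identifies R/(y) with (z) = Ann(y), the y-torsion of R. -/
lemma IsExactZeroDivisorPair.hasInjectiveDimensionLE {y z : R} (h : IsExactZeroDivisorPair y z)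
    (d : ℕ) [HasInjectiveDimensionLE (ModuleCat.of R R) d] :
    HasInjectiveDimensionLE
      (ModuleCat.of (R ⧸ Ideal.span {y}) (R ⧸ Ideal.span {y})) d := by
  obtain ⟨f, -, hf, hex⟩ := h.exists_exact
  refine ModuleCat.hasInjectiveDimensionLE_torsionBySet _ d h.subsingleton_ext f hf fun e he ↦ ?_
  rw [← LinearMap.exact_iff.mp hex, Submodule.ker_mkQ, Ideal.mem_span_singleton, ← (h e).1]
  exact he y (Ideal.mem_span_singleton_self y)

lemma IsSMulRegular.subsingleton_ext_quotient {x : R} (hx : IsSMulRegular R x)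
    (N : ModuleCat.{u} R) (i : ℕ) :
    Subsingleton (Ext (ModuleCat.of R (R ⧸ Ideal.span {x})) N (i + 2)) := by
  obtain ⟨f, -, hf, hex⟩ := Ideal.exists_exact_quotient_span_singleton (I := (⊥ : Ideal R))
    (z := x) fun a ↦ by
      rw [Ideal.mem_bot]
      exact ⟨fun h ↦ by rw [h, mul_zero], fun h ↦ hx.right_eq_zero_of_smul h⟩
  exact (hex.shortExact_moduleCat hf (Submodule.mkQ_surjective _)).subsingleton_ext_contravariant₃
    _ _ (Ext.subsingleton_of_linearEquiv (Submodule.quotEquivOfEqBot ⊥ rfl).symm _ _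
      (Ext.subsingleton_of_self _ _)) (Ext.subsingleton_of_self _ _)

/-- An element of an injective module is divisible by every regular element of the ring. -/
lemma Module.Injective.exists_smul_eq {x : R} (hx : IsSMulRegular R x) {E : Type u}
    [AddCommGroup E] [Module R E] [Module.Injective R E] (e : E) : ∃ e' : E, x • e' = e := by
  obtain ⟨h, hh⟩ := Module.Injective.out (LinearMap.toSpanSingleton R R x)
    (fun a b hab ↦ hx (by simpa [mul_comm] using hab)) (LinearMap.toSpanSingleton R E e)
  refine ⟨h 1, ?_⟩
  have := hh 1
  simp only [LinearMap.toSpanSingleton_apply, one_smul] at this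
  rw [← this, ← map_smul, smul_eq_mul, mul_one]

/-- A module is a retract of its product with another module. -/
def ModuleCat.retractProd (R N M : Type u) [CommRing R] [AddCommGroup N] [AddCommGroup M]
    [Module R N] [Module R M] : Retract (ModuleCat.of R M) (ModuleCat.of R (N × M)) where
  i := ModuleCat.ofHom (LinearMap.inr R N M)
  r := ModuleCat.ofHom (LinearMap.snd R N M)
  retract := rfl

/-- For 0 → R → E → Q → 0 with E injective, Q has injective dimension at most d and its x-torsion is
E[x] ⊕ R/(x), so R/(x) is a retract of a module of injective dimension at most d over R/(x). -/
lemma IsSMulRegular.hasInjectiveDimensionLE_quotient {x : R} (hx : IsSMulRegular R x) (d : ℕ)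
    [hd : HasInjectiveDimensionLE (ModuleCat.of R R) (d + 1)] :
    HasInjectiveDimensionLE
      (ModuleCat.of (R ⧸ Ideal.span {x}) (R ⧸ Ideal.span {x})) d := by
  set J := Ideal.span {x}
  have hxJ : x ∈ J := Ideal.mem_span_singleton_self x
  obtain ⟨E, Q, f, g, hE, hex, hf, hg⟩ := ModuleCat.exists_injective_exact (R := R) R
  have hS := hex.shortExact_moduleCat hf hg
  have : Injective E := Module.injective_object_of_injective_module R E
  have hQ : HasInjectiveDimensionLE Q d := (hS.hasInjectiveDimensionLT_X₃_iff d this).mpr hd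
  -- The class of e₀ = "1/x" in Q generates the summand R/(x).
  obtain ⟨e₀, he₀⟩ := Module.Injective.exists_smul_eq hx (f 1)
  let P := Submodule.torsionBySet R E (J : Set R) × (R ⧸ J)
  let ψ : (R ⧸ J) →ₗ[R] Q := J.liftQ (LinearMap.toSpanSingleton R Q (g e₀)) <| by
    rw [Ideal.span_singleton_le_iff_mem]
    simp [← map_smul, he₀, hex.apply_apply_eq_zero]
  have hψ (r : R) : ψ (Submodule.mkQ J r) = g (r • e₀) := by
    rw [map_smul]; exact Submodule.liftQ_apply _ _ _
  let j : P →ₗ[R] Q := (g ∘ₗ Submodule.subtype _).coprod ψ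
  have hj : Function.Injective j := by
    rw [injective_iff_map_eq_zero]
    rintro ⟨⟨e, he⟩, c⟩ h
    obtain ⟨r, rfl⟩ := Submodule.mkQ_surjective J c
    have hxe : x • e = 0 := (Submodule.mem_torsionBySet_iff _ _).mp he ⟨x, hxJ⟩
    have h' : g (e + r • e₀) = 0 := by rw [map_add, ← hψ]; exact h
    obtain ⟨s, hs⟩ := (hex _).mp h'
    have hr : r = x * s := hf <| by
      rw [← smul_eq_mul x s, map_smul, hs, smul_add, hxe, zero_add, smul_comm, he₀, ← map_smul,
        smul_eq_mul, mul_one]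
    have hc : Submodule.mkQ J r = 0 := by
      rw [Submodule.mkQ_apply, Submodule.Quotient.mk_eq_zero, hr]
      exact J.mul_mem_right _ hxJ
    have he' : e = 0 := by
      have h2 : f s = e + s • f 1 := by
        rw [hs, hr, ← he₀, ← mul_smul, mul_comm]
      rw [← map_smul, smul_eq_mul, mul_one] at h2
      exact left_eq_add.mp (h2.trans (add_comm _ _))
    exact Prod.ext (Subtype.ext he') hc
  have hP : HasInjectiveDimensionLE (ModuleCat.of (R ⧸ J) P) d := by
    refine ModuleCat.hasInjectiveDimensionLE_torsionBySet J d (N := Q) (fun i ↦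
      hS.subsingleton_ext_covariant₃ _ _
        (HasInjectiveDimensionLT.subsingleton E 1 (i + 1) (by lia) _)
        (hx.subsingleton_ext_quotient _ i)) j hj fun q hq ↦ ?_
    obtain ⟨e, rfl⟩ := hg q
    have h' : g (x • e) = 0 := by rw [map_smul]; exact hq x hxJ
    obtain ⟨r, hr⟩ := (hex _).mp h'
    have hmem : e - r • e₀ ∈ Submodule.torsionBySet R E (J : Set R) := by
      rw [Submodule.torsionBySet_ideal_span_singleton_eq, Submodule.mem_torsionBy_iff, smul_sub,
        ← hr, smul_comm, he₀, ← map_smul, smul_eq_mul, mul_one, sub_self]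
    refine ⟨(⟨e - r • e₀, hmem⟩, Submodule.mkQ J r), ?_⟩
    change g (e - r • e₀) + ψ (Submodule.mkQ J r) = g e
    rw [hψ, ← map_add, sub_add_cancel]
  exact (ModuleCat.retractProd (R ⧸ J) (Submodule.torsionBySet R E (J : Set R)) (R ⧸ J)).hasInjectiveDimensionLT (d + 1)

end

/-! ### Self-injective Noetherian local rings. -/

section SelfInjective

variable {R : Type u} [CommRing R]

/-- In a self-injective ring, `(a)` is its own double annihilator. -/
lemma Module.Injective.dvd_of_forall_mul_eq_zero [Module.Injective R R] {a b : R}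
    (h : ∀ t, a * t = 0 → b * t = 0) : a ∣ b := by
  let K := LinearMap.ker (LinearMap.toSpanSingleton R R a)
  obtain ⟨φ, hφ⟩ := Module.Injective.out
    (K.liftQ (LinearMap.toSpanSingleton R R a) le_rfl)
    (LinearMap.ker_eq_bot.mp (Submodule.ker_liftQ_eq_bot _ _ _ le_rfl))
    (K.liftQ (LinearMap.toSpanSingleton R R b) fun t ht ↦ by
      simpa [mul_comm] using h t (by simpa [K, mul_comm] using ht))
  have h1 := hφ (K.mkQ 1)
  rw [Submodule.mkQ_apply, Submodule.liftQ_apply, Submodule.liftQ_apply] at h1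
  simp only [LinearMap.toSpanSingleton_apply, one_smul] at h1
  refine ⟨φ 1, ?_⟩
  rw [← h1, ← smul_eq_mul a, ← map_smul, smul_eq_mul, mul_one]

namespace IsLocalRing

variable [IsLocalRing R]

/-- The multiplier t comes from the highest power of the maximal ideal that does not kill a. -/
lemma exists_mul_ne_zero_of_maximalIdeal_pow {k : ℕ} {a : R} (ha : a ≠ 0)
    (hk : ∀ s ∈ maximalIdeal R ^ k, s * a = 0) :
    ∃ t, t * a ≠ 0 ∧ ∀ s ∈ maximalIdeal R, s * (t * a) = 0 := by
  induction k with
  | zero => exact absurd (by simpa using hk 1 (by simp)) ha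
  | succ k ih =>
    by_cases h : ∀ s ∈ maximalIdeal R ^ k, s * a = 0
    · exact ih h
    · push Not at h
      obtain ⟨t, ht, hta⟩ := h
      refine ⟨t, hta, fun s hs ↦ ?_⟩
      rw [← mul_assoc]
      exact hk _ (pow_succ' (maximalIdeal R) k ▸ Ideal.mul_mem_mul hs ht)

/-- For a in the maximal ideal the chain Ann(a^n) stabilizes, so double annihilators give a^n =
a^{n+1}c. As 1 - ac is a unit, a is nilpotent. -/
lemma exists_maximalIdeal_pow_eq_bot_of_injective [IsNoetherianRing R] [Module.Injective R R] :
    ∃ k, maximalIdeal R ^ k = ⊥ := by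
  obtain ⟨k, hk⟩ := IsNoetherianRing.isNilpotent_nilradical R
  refine ⟨k, le_bot_iff.mp (le_of_le_of_eq (Ideal.pow_right_mono (fun a ha ↦ ?_) k) hk)⟩
  let F : ℕ →o Ideal R :=
    { toFun n := LinearMap.ker (LinearMap.toSpanSingleton R R (a ^ n))
      monotone' m n hmn t ht := by
        obtain ⟨c, hc⟩ := pow_dvd_pow a hmn
        have ht' : t * a ^ m = 0 := by simpa using ht
        simp [hc, ← mul_assoc, ht'] }
  have hF (n : ℕ) (t : R) : t ∈ F n ↔ t * a ^ n = 0 := by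
    change t ∈ LinearMap.ker _ ↔ _
    simp
  obtain ⟨n, hn⟩ := monotone_stabilizes_iff_noetherian.mpr ‹IsNoetherianRing R› F
  obtain ⟨c, hc⟩ : a ^ (n + 1) ∣ a ^ n := Module.Injective.dvd_of_forall_mul_eq_zero fun t ht ↦ by
    rw [mul_comm, ← hF] at ht ⊢
    rwa [hn (n + 1) n.le_succ]
  have hunit : IsUnit (1 - a * c) := by
    by_contra h
    have h1 := Ideal.add_mem _ ((mem_maximalIdeal _).mpr h) (Ideal.mul_mem_right c _ ha)
    rw [sub_add_cancel] at h1
    exact (Ideal.ne_top_iff_one _).mp (maximalIdeal.isMaximal R).ne_top h1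
  exact ⟨n, hunit.mul_left_eq_zero.mp (by linear_combination hc)⟩

/-- A self-injective Noetherian local ring has an element that generates its
socle. -/
lemma exists_ne_zero_forall_dvd_of_injective [IsNoetherianRing R] [Module.Injective R R] :
    ∃ w : R, w ≠ 0 ∧ ∀ a : R, a ≠ 0 → a ∣ w := by
  obtain ⟨k, hk⟩ := exists_maximalIdeal_pow_eq_bot_of_injective (R := R)
  have hk' (a : R) : ∀ s ∈ maximalIdeal R ^ k, s * a = 0 := fun s hs ↦ by
    rw [hk, Ideal.mem_bot] at hs
    rw [hs, zero_mul]
  obtain ⟨t, ht, htm⟩ := exists_mul_ne_zero_of_maximalIdeal_pow one_ne_zero (hk' 1)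
  refine ⟨t * 1, ht, fun a ha ↦ ?_⟩
  obtain ⟨s, hs, hsm⟩ := exists_mul_ne_zero_of_maximalIdeal_pow ha (hk' a)
  -- Whatever kills the nonzero element sa is a nonunit, so it kills the socle element t; hence sa
  -- divides t.
  refine (Dvd.intro_left s rfl).trans (Module.Injective.dvd_of_forall_mul_eq_zero fun r hr ↦ ?_)
  rw [mul_comm]
  refine htm r ?_
  by_contra h
  exact hs ((notMem_maximalIdeal.mp h).mul_left_eq_zero.mp hr)

-- Lift a socle generator of R/(y) to w. As y does not divide w, some z kills y but not w. If za = 0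
-- with a outside (y), then a divides w modulo y and zw = 0, a contradiction; so Ann(z) = (y), and
-- Ann(y) = Ann(Ann(z)) = (z).
omit [IsLocalRing R] in
lemma exists_isExactZeroDivisorPair_of_injective [IsNoetherianRing R] [Module.Injective R R]
    {y : R} [IsLocalRing (R ⧸ Ideal.span {y})]
    [Module.Injective (R ⧸ Ideal.span {y}) (R ⧸ Ideal.span {y})] :
    ∃ z, IsExactZeroDivisorPair y z := by
  obtain ⟨w, hw, hdvd⟩ := exists_ne_zero_forall_dvd_of_injective (R := R ⧸ Ideal.span {y})
  obtain ⟨w, rfl⟩ := Ideal.Quotient.mk_surjective w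
  have hyw : ¬ y ∣ w := by
    rwa [Ne, Ideal.Quotient.eq_zero_iff_mem, Ideal.mem_span_singleton] at hw
  obtain ⟨z, hyz, hwz⟩ : ∃ z, y * z = 0 ∧ w * z ≠ 0 := by
    by_contra! h
    exact hyw (Module.Injective.dvd_of_forall_mul_eq_zero h)
  have hz (a : R) : z * a = 0 ↔ y ∣ a := by
    refine ⟨fun h ↦ ?_, ?_⟩
    · by_contra hya
      obtain ⟨t, ht⟩ := hdvd (Ideal.Quotient.mk _ a) (by
        rwa [Ne, Ideal.Quotient.eq_zero_iff_mem, Ideal.mem_span_singleton])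
      obtain ⟨t, rfl⟩ := Ideal.Quotient.mk_surjective t
      rw [← map_mul, Ideal.Quotient.eq, Ideal.mem_span_singleton] at ht
      obtain ⟨s, hs⟩ := ht
      exact hwz (by linear_combination z * hs + s * hyz + t * h)
    · rintro ⟨c, rfl⟩
      linear_combination c * hyz
  refine ⟨z, fun a ↦ ⟨⟨fun h ↦ ?_, ?_⟩, hz a⟩⟩
  · refine Module.Injective.dvd_of_forall_mul_eq_zero fun t ht ↦ ?_
    obtain ⟨c, rfl⟩ := (hz t).mp ht
    linear_combination c * h
  · rintro ⟨c, rfl⟩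
    linear_combination c * hyz

end IsLocalRing

end SelfInjective

/-! ### Lifting exact zero divisors modulo a regular element. -/

section Lift

variable {R : Type u} [CommRing R] [IsLocalRing R] [IsNoetherianRing R]

open IsLocalRing

/-- Nakayama applied to K ⊆ (z) + sK. -/
lemma Ideal.le_span_singleton_of_local {s z : R} (hs : s ∈ maximalIdeal R) (K : Ideal R)
    (h : ∀ a ∈ K, ∃ t, ∃ b ∈ K, a = z * t + s * b) : K ≤ Ideal.span {z} := by
  refine Submodule.le_of_le_smul_of_le_jacobson_bot (I := maximalIdeal R) (IsNoetherian.noetherian K)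
    (IsLocalRing.maximalIdeal_le_jacobson ⊥) fun a ha ↦ ?_
  obtain ⟨t, b, hb, rfl⟩ := h a ha
  exact Submodule.add_mem_sup (Ideal.mul_mem_right _ _ (Ideal.mem_span_singleton_self z))
    (Submodule.smul_mem_smul hs hb)

/-- A zero divisor stays a zero divisor modulo a regular element. -/
lemma IsSMulRegular.exists_mul_eq_zero_mk_ne_zero {s y z : R} (hs : s ∈ maximalIdeal R)
    (hreg : IsSMulRegular R s) (hz : z ≠ 0) (hyz : y * z = 0) :
    ∃ z' : R, y * z' = 0 ∧ Ideal.Quotient.mk (Ideal.span {s}) z' ≠ 0 := by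
  by_contra! h
  -- If s divided all of Ann(y), then Ann(y) = s Ann(y), hence Ann(y) = 0.
  have hle := Ideal.le_span_singleton_of_local (z := 0) hs
    (LinearMap.ker (LinearMap.toSpanSingleton R R y)) fun a ha ↦ by
      have ha' : y * a = 0 := by simpa [mul_comm] using ha
      obtain ⟨b, rfl⟩ := Ideal.mem_span_singleton.mp (Ideal.Quotient.eq_zero_iff_mem.mp (h a ha'))
      refine ⟨0, b, ?_, by ring⟩
      have : y * b = 0 := hreg.right_eq_zero_of_smul (by rw [smul_eq_mul, ← ha']; ring)
      simpa [mul_comm] using this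
  have hz' : z ∈ Ideal.span {(0 : R)} := hle (by simpa [mul_comm] using hyz)
  exact hz (by simpa using hz')

lemma IsExactZeroDivisorPair.exists_of_quotient {s y : R} (hs : s ∈ maximalIdeal R)
    (hreg : IsSMulRegular R s) (hreg' : IsSMulRegular (R ⧸ Ideal.span {y}) s)
    {z : R ⧸ Ideal.span {s}} (h : IsExactZeroDivisorPair (Ideal.Quotient.mk _ y) z) :
    ∃ z, IsExactZeroDivisorPair y z := by
  have hreg₁ {a : R} (ha : s * a = 0) : a = 0 := hreg.right_eq_zero_of_smul ha
  have hreg₂ {a : R} (ha : y ∣ s * a) : y ∣ a := by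
    rw [← Ideal.mem_span_singleton, ← Ideal.Quotient.eq_zero_iff_mem] at ha ⊢
    exact hreg'.right_eq_zero_of_smul ha
  have hmk {a b : R} (hab : Ideal.Quotient.mk (Ideal.span {s}) a ∣ Ideal.Quotient.mk _ b) :
      ∃ t c, b = a * t + s * c := by
    obtain ⟨t, ht⟩ := hab
    obtain ⟨t, rfl⟩ := Ideal.Quotient.mk_surjective t
    rw [← map_mul, Ideal.Quotient.eq, Ideal.mem_span_singleton] at ht
    obtain ⟨c, hc⟩ := ht
    exact ⟨t, c, by linear_combination hc⟩
  have hmk0 {a b : R} (hab : a * b = 0) : Ideal.Quotient.mk (Ideal.span {s}) a *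
      Ideal.Quotient.mk _ b = 0 := by rw [← map_mul, hab, map_zero]
  obtain ⟨z₀, rfl⟩ := Ideal.Quotient.mk_surjective z
  obtain ⟨b, hb⟩ : s ∣ y * z₀ := by
    rw [← Ideal.mem_span_singleton, ← Ideal.Quotient.eq_zero_iff_mem, map_mul]
    exact (h _).1.mpr dvd_rfl
  -- Regularity of s on R/(y) turns y z₀ = s b into b = yc, so z₀ - sc is a lift that y kills
  -- exactly.
  obtain ⟨c, rfl⟩ := hreg₂ (Dvd.intro _ hb)
  set z := z₀ - s * c with hz
  have hyz : y * z = 0 := by linear_combination hb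
  have hmkz : Ideal.Quotient.mk (Ideal.span {s}) z₀ = Ideal.Quotient.mk _ z := by
    rw [Ideal.Quotient.eq, Ideal.mem_span_singleton]
    exact ⟨c, by rw [hz]; ring⟩
  rw [hmkz] at h
  refine ⟨z, fun a ↦ ⟨⟨fun ha ↦ ?_, ?_⟩, ⟨fun ha ↦ ?_, ?_⟩⟩⟩
  · refine Ideal.mem_span_singleton.mp (Ideal.le_span_singleton_of_local hs
      (LinearMap.ker (LinearMap.toSpanSingleton R R y)) (fun a ha ↦ ?_)
      (by simpa [mul_comm] using ha))
    replace ha : y * a = 0 := by simpa [mul_comm] using ha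
    obtain ⟨t, b, rfl⟩ := hmk ((h _).1.mp (hmk0 ha))
    have : y * b = 0 := hreg₁ (by linear_combination ha - t * hyz)
    exact ⟨t, b, by simpa [mul_comm] using this, rfl⟩
  · rintro ⟨t, rfl⟩
    linear_combination t * hyz
  · refine Ideal.mem_span_singleton.mp (Ideal.le_span_singleton_of_local hs
      (LinearMap.ker (LinearMap.toSpanSingleton R R z)) (fun a ha ↦ ?_)
      (by simpa [mul_comm] using ha))
    replace ha : z * a = 0 := by simpa [mul_comm] using ha
    obtain ⟨t, b, rfl⟩ := hmk ((h _).2.mp (hmk0 ha))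
    have : z * b = 0 := hreg₁ (by linear_combination ha - t * hyz)
    exact ⟨t, b, by simpa [mul_comm] using this, rfl⟩
  · rintro ⟨t, rfl⟩
    linear_combination t * hyz

end Lift

/-! ### Gorenstein quotients and the existence of exact zero divisors. -/

section

open IsLocalRing

attribute [local instance] RingHomInvPair.of_ringEquiv in
lemma IsGorensteinLocalRing.of_ringEquiv {R R' : Type u} [CommRing R] [CommRing R']
    [h : IsGorensteinLocalRing R] (e : R ≃+* R') : IsGorensteinLocalRing R' := by
  obtain ⟨d, hd⟩ := h.exists_hasInjectiveDimensionLE_self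
  let e' : ModuleCat.of R R ≃ₛₗ[RingHomClass.toRingHom e] ModuleCat.of R' R' :=
    { e.toAddEquiv with map_smul' := fun r x ↦ map_mul e r x }
  exact { e.isLocalRing, isNoetherianRing_of_ringEquiv R e with
    exists_hasInjectiveDimensionLE_self :=
      ⟨d, (ModuleCat.hasInjectiveDimensionLE_iff_of_semiLinearEquiv e e' d).mp hd⟩ }

variable {R : Type u} [CommRing R]

lemma IsLocalRing.isLocalRing_quotient [IsLocalRing R] {I : Ideal R} (hI : I ≤ maximalIdeal R) :
    IsLocalRing (R ⧸ I) :=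
  have := Ideal.Quotient.nontrivial_iff.mpr
    (ne_top_of_le_ne_top (maximalIdeal.isMaximal R).ne_top hI)
  .of_surjective' (Ideal.Quotient.mk I) Ideal.Quotient.mk_surjective

lemma IsLocalRing.mk_mem_maximalIdeal_iff [IsLocalRing R] {I : Ideal R} [IsLocalRing (R ⧸ I)]
    {a : R} : Ideal.Quotient.mk I a ∈ maximalIdeal (R ⧸ I) ↔ a ∈ maximalIdeal R := by
  rw [← eq_maximalIdeal (Ideal.comap_isMaximal_of_surjective (Ideal.Quotient.mk I)
    Ideal.Quotient.mk_surjective (K := maximalIdeal (R ⧸ I))), Ideal.mem_comap]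

lemma IsGorensteinLocalRing.quotient_span_singleton [h : IsGorensteinLocalRing R] {x : R}
    (hx : x ∈ maximalIdeal R) (hreg : IsSMulRegular R x) :
    IsGorensteinLocalRing (R ⧸ Ideal.span {x}) := by
  obtain ⟨d, hd⟩ := h.exists_hasInjectiveDimensionLE_self
  -- The bound is weakened to d + 1 because the quotient lemma needs a positive one.
  have := hasInjectiveDimensionLT_of_ge (ModuleCat.of R R) (d + 1) (d + 2) (by lia)
  exact { isLocalRing_quotient ((Ideal.span_singleton_le_iff_mem _).mpr hx),
    (inferInstance : IsNoetherianRing (R ⧸ Ideal.span {x})) with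
    exists_hasInjectiveDimensionLE_self := ⟨d, hreg.hasInjectiveDimensionLE_quotient d⟩ }

lemma IsExactZeroDivisorPair.isGorensteinLocalRing [h : IsGorensteinLocalRing R] {y z : R}
    (hy : y ∈ maximalIdeal R) (hyz : IsExactZeroDivisorPair y z) :
    IsGorensteinLocalRing (R ⧸ Ideal.span {y}) := by
  obtain ⟨d, hd⟩ := h.exists_hasInjectiveDimensionLE_self
  exact { isLocalRing_quotient ((Ideal.span_singleton_le_iff_mem _).mpr hy),
    (inferInstance : IsNoetherianRing (R ⧸ Ideal.span {y})) with
    exists_hasInjectiveDimensionLE_self := ⟨d, hyz.hasInjectiveDimensionLE d⟩ }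

variable [IsLocalRing R] [IsNoetherianRing R]

/-- Either the maximal ideal contains a regular element on `M`, or `M` has nonzero socle. -/
lemma IsLocalRing.exists_isSMulRegular_or_exists_socle (M : Type u) [AddCommGroup M] [Module R M]
    [Module.Finite R M] : (∃ s ∈ maximalIdeal R, IsSMulRegular M s) ∨
      ∃ u : M, u ≠ 0 ∧ ∀ a ∈ maximalIdeal R, a • u = 0 := by
  rw [or_iff_not_imp_left]
  intro h
  have hns : ¬ Subsingleton ((R ⧸ maximalIdeal R) →ₗ[R] M) := by
    rwa [IsSMulRegular.subsingleton_linearMap_iff, Ideal.annihilator_quotient]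
  rw [not_subsingleton_iff_nontrivial] at hns
  obtain ⟨f, hf⟩ := exists_ne (0 : (R ⧸ maximalIdeal R) →ₗ[R] M)
  refine ⟨f (Submodule.mkQ _ 1), fun h0 ↦ hf ?_, fun a ha ↦ ?_⟩
  · ext
    simpa using h0
  · rw [← map_smul, ← map_smul, smul_eq_mul, mul_one, Submodule.mkQ_apply,
      (Submodule.Quotient.mk_eq_zero _).mpr ha, map_zero]

/-- If `R` has depth zero and the zero divisor `y` generates a Gorenstein ideal, then `y` is part of
a pair of exact zero divisors. -/
lemma IsLocalRing.exists_isExactZeroDivisorPair_of_socle (d : ℕ)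
    [hd : HasInjectiveDimensionLE (ModuleCat.of R R) d] {y z : R} (hz : z ≠ 0)
    (hyz : y * z = 0) [hA : IsGorensteinLocalRing (R ⧸ Ideal.span {y})]
    (hu : ∃ u : R × (R ⧸ Ideal.span {y}), u ≠ 0 ∧ ∀ a ∈ maximalIdeal R, a • u = 0) :
    ∃ z, IsExactZeroDivisorPair y z := by
  obtain ⟨e, he⟩ := hA.exists_hasInjectiveDimensionLE_self
  have hsocle : ∃ u : R, u ≠ 0 ∧ ∀ a ∈ maximalIdeal R, a * u = 0 := by
    obtain ⟨⟨u, v⟩, huv, hm⟩ := hu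
    by_cases hu : u = 0
    -- Here the socle of R/(y) is nonzero, so R/(y) is self-injective and a power of the maximal
    -- ideal of R lies in (y). It kills z, so a multiple of z is a nonzero socle element of R.
    · have hv : v ≠ 0 := fun hv ↦ huv (by rw [hu, hv]; rfl)
      have : Module.Injective (R ⧸ Ideal.span {y}) (R ⧸ Ideal.span {y}) :=
        injective_self_of_hasInjectiveDimensionLE hv (fun a ha ↦ by
          obtain ⟨a, rfl⟩ := Ideal.Quotient.mk_surjective a
          exact congrArg Prod.snd (hm a (mk_mem_maximalIdeal_iff.mp ha))) e he
      obtain ⟨k, hk⟩ := exists_maximalIdeal_pow_eq_bot_of_injective (R := R ⧸ Ideal.span {y})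
      obtain ⟨t, ht, htm⟩ := exists_mul_ne_zero_of_maximalIdeal_pow (k := k) hz fun s hs ↦ by
        have hmap : Ideal.Quotient.mk (Ideal.span {y}) s ∈
            maximalIdeal (R ⧸ Ideal.span {y}) ^ k := by
          refine Ideal.pow_right_mono (Ideal.map_le_iff_le_comap.mpr fun a ha ↦ ?_) k
            (Ideal.map_pow (Ideal.Quotient.mk (Ideal.span {y})) (maximalIdeal R) k ▸
              Ideal.mem_map_of_mem _ hs)
          exact mk_mem_maximalIdeal_iff.mpr ha
        rw [hk, Ideal.mem_bot, Ideal.Quotient.eq_zero_iff_mem, Ideal.mem_span_singleton] at hmap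
        obtain ⟨c, rfl⟩ := hmap
        linear_combination c * hyz
      exact ⟨_, ht, htm⟩
    · exact ⟨u, hu, fun a ha ↦ congrArg Prod.fst (hm a ha)⟩
  obtain ⟨u, hu, hum⟩ := hsocle
  have : Module.Injective R R := injective_self_of_hasInjectiveDimensionLE hu hum d hd
  obtain ⟨k, hk⟩ := exists_maximalIdeal_pow_eq_bot_of_injective (R := R)
  have hkA : maximalIdeal (R ⧸ Ideal.span {y}) ^ k = ⊥ := by
    have hmap : maximalIdeal (R ⧸ Ideal.span {y}) =
        (maximalIdeal R).map (Ideal.Quotient.mk (Ideal.span {y})) := by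
      refine le_antisymm (fun a ha ↦ ?_) (Ideal.map_le_iff_le_comap.mpr fun a ha ↦
        mk_mem_maximalIdeal_iff.mpr ha)
      obtain ⟨a, rfl⟩ := Ideal.Quotient.mk_surjective a
      exact Ideal.mem_map_of_mem _ (mk_mem_maximalIdeal_iff.mp ha)
    rw [hmap, ← Ideal.map_pow, hk, Ideal.map_bot]
  obtain ⟨v, hv, hvm⟩ := exists_mul_ne_zero_of_maximalIdeal_pow (R := R ⧸ Ideal.span {y}) (k := k)
    one_ne_zero fun s hs ↦ by
      rw [hkA, Ideal.mem_bot] at hs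
      rw [hs, zero_mul]
  have := injective_self_of_hasInjectiveDimensionLE hv hvm e he
  exact exists_isExactZeroDivisorPair_of_injective

-- Induction on d by factoring out an s regular on R × R/(y), hence on both factors. If there is
-- none, the product has nonzero socle and the depth-zero case applies.
omit [IsLocalRing R] [IsNoetherianRing R] in
lemma IsLocalRing.exists_isExactZeroDivisorPair [IsLocalRing R] [IsNoetherianRing R] (d : ℕ)
    [hd : HasInjectiveDimensionLE (ModuleCat.of R R) d] {y z : R} (hy : y ∈ maximalIdeal R)
    (hz : z ≠ 0) (hyz : y * z = 0) [hA : IsGorensteinLocalRing (R ⧸ Ideal.span {y})] :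
    ∃ z, IsExactZeroDivisorPair y z := by
  induction d generalizing R with
  | zero =>
    obtain ⟨s, hs, hreg⟩ | hu :=
      exists_isSMulRegular_or_exists_socle (R := R) (R × (R ⧸ Ideal.span {y}))
    · have := injective_iff_hasInjectiveDimensionLT_one.mpr hd
      have := Module.injective_module_of_injective_object R R
      -- Regular elements of a self-injective ring are units.
      have hs1 : s ∣ 1 := Module.Injective.dvd_of_forall_mul_eq_zero fun t ht ↦ by
        have h := hreg.right_eq_zero_of_smul (x := ((t, 0) : R × (R ⧸ Ideal.span {y})))
          (Prod.ext ht (smul_zero s))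
        rw [one_mul]
        exact congrArg Prod.fst h
      exact absurd (isUnit_of_dvd_one hs1) hs
    · exact exists_isExactZeroDivisorPair_of_socle 0 hz hyz hu
  | succ d ih =>
    obtain ⟨s, hs, hreg⟩ | hu :=
      exists_isSMulRegular_or_exists_socle (R := R) (R × (R ⧸ Ideal.span {y}))
    · have hreg₁ : IsSMulRegular R s := fun a b hab ↦
        congrArg Prod.fst (hreg (a₁ := ((a, 0) : R × (R ⧸ Ideal.span {y}))) (a₂ := (b, 0))
          (Prod.ext hab rfl))
      have hreg₂ : IsSMulRegular (R ⧸ Ideal.span {y}) s := fun a b hab ↦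
        congrArg Prod.snd (hreg (a₁ := ((0, a) : R × (R ⧸ Ideal.span {y}))) (a₂ := (0, b))
          (Prod.ext rfl hab))
      have hloc : IsLocalRing (R ⧸ Ideal.span {s}) :=
        isLocalRing_quotient ((Ideal.span_singleton_le_iff_mem _).mpr hs)
      have hdim := hreg₁.hasInjectiveDimensionLE_quotient d
      have hA' := hA.quotient_span_singleton (x := Ideal.Quotient.mk _ s)
        (mk_mem_maximalIdeal_iff.mpr hs) hreg₂
      have hG : IsGorensteinLocalRing
          ((R ⧸ Ideal.span {s}) ⧸ Ideal.span {Ideal.Quotient.mk (Ideal.span {s}) y}) := by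
        have hmap (a b : R) : Ideal.span {Ideal.Quotient.mk (Ideal.span {a}) b} =
            (Ideal.span {b}).map (Ideal.Quotient.mk (Ideal.span {a})) := by
          rw [Ideal.map_span, Set.image_singleton]
        exact .of_ringEquiv (((Ideal.quotEquivOfEq (hmap y s)).trans (DoubleQuot.quotQuotEquivComm
          (Ideal.span {y}) (Ideal.span {s}))).trans (Ideal.quotEquivOfEq (hmap s y).symm))
      obtain ⟨z', hz', hz'0⟩ := hreg₁.exists_mul_eq_zero_mk_ne_zero hs hz hyz
      obtain ⟨w, hw⟩ := ih (mk_mem_maximalIdeal_iff.mpr hy) hz'0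
        (by rw [← map_mul, hz', map_zero])
      exact hw.exists_of_quotient hs hreg₁ hreg₂
    · exact exists_isExactZeroDivisorPair_of_socle (d + 1) hz hyz hu

end

/-! ### Regular sequences: height, Ext, and the main theorem. -/

section

variable {R : Type u} [CommRing R]

open RingTheory.Sequence Ideal

/-- The last element is regular modulo the others, so it avoids every minimal prime over them, and
each step raises the height. -/
lemma RingTheory.Sequence.IsWeaklyRegular.length_le_height_of_isPrime {rs : List R}
    (h : IsWeaklyRegular R rs) {p : Ideal R} [hp : p.IsPrime] (hle : Ideal.ofList rs ≤ p) :
    rs.length ≤ p.height := by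
  induction rs using List.reverseRecOn generalizing p with
  | nil => simp
  | append_singleton rs y ih =>
    rw [isWeaklyRegular_append_iff, isWeaklyRegular_singleton_iff] at h
    rw [ofList_append, sup_le_iff, ofList_singleton, span_singleton_le_iff_mem] at hle
    obtain ⟨q, hq, hqp⟩ := exists_minimalPrimes_le hle.1
    have : q.IsPrime := hq.1.1
    have hyq : y ∉ q := by
      refine h.2.notMem_of_mem_minimalPrimes ?_
      rwa [annihilator_quotient, smul_eq_mul, mul_top]
    have hlt : q < p := lt_of_le_of_ne hqp fun h ↦ hyq (h ▸ hle.2)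
    rw [List.length_append, List.length_singleton, Nat.cast_add, Nat.cast_one]
    exact (add_le_add_left (ih h.1 hq.1.2) 1).trans (height_add_one_le_of_lt_of_isPrime hlt)

lemma RingTheory.Sequence.IsWeaklyRegular.length_le_height {rs : List R}
    (h : IsWeaklyRegular R rs) : rs.length ≤ (Ideal.ofList rs).height := by
  rw [height_eq_inf_minimalPrimes]
  refine le_iInf₂ fun p hp ↦ ?_
  have := hp.1.1
  exact h.length_le_height_of_isPrime hp.1.2

lemma CategoryTheory.Abelian.Ext.smul_eq_zero_of_mem_annihilator {M N : ModuleCat.{u} R} {i : ℕ}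
    {a : R} (ha : a ∈ Module.annihilator R M) (e : Ext M N i) : a • e = 0 := by
  have h : a • 𝟙 M = 0 := by
    ext m
    exact Module.mem_annihilator.mp ha m
  rw [← Ext.mk₀_smul_id_comp, h, Ext.mk₀_zero, Ext.zero_comp]

/-- Multiplication by a is zero on Ext(M, N), so the connecting map is onto. -/
lemma CategoryTheory.Abelian.Ext.exists_comp_extClass_eq_of_mem_annihilator
    {M N : ModuleCat.{u} R} {i : ℕ} {a : R} (hreg : IsSMulRegular N a)
    (ha : a ∈ Module.annihilator R M) (e : Ext M N (i + 1)) :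
    ∃ e' : Ext M (ModuleCat.of R (QuotSMulTop a N)) i,
      e'.comp hreg.smulShortComplex_shortExact.extClass rfl = e :=
  Ext.covariant_sequence_exact₁ M hreg.smulShortComplex_shortExact e
    ((Ext.smul_eq_comp_mk₀ e a).symm.trans (Ext.smul_eq_zero_of_mem_annihilator ha e)) rfl

lemma RingTheory.Sequence.IsWeaklyRegular.subsingleton_ext {M N : ModuleCat.{u} R} {rs : List R}
    (h : IsWeaklyRegular N rs) (hrs : ∀ r ∈ rs, r ∈ Module.annihilator R M) {i : ℕ}
    (hi : i < rs.length) : Subsingleton (Ext M N i) := by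
  induction rs generalizing N i with
  | nil => simp at hi
  | cons a rs ih =>
    rw [isWeaklyRegular_cons_iff] at h
    rw [List.forall_mem_cons] at hrs
    obtain _ | i := i
    · have : Subsingleton (M →ₗ[R] N) :=
        IsSMulRegular.linearMap_subsingleton_of_mem_annihilator h.1 hrs.1
      exact (Ext.addEquiv₀.trans ModuleCat.homAddEquiv).subsingleton
    · refine subsingleton_of_forall_eq 0 fun e ↦ ?_
      obtain ⟨e', rfl⟩ := Ext.exists_comp_extClass_eq_of_mem_annihilator h.1 hrs.1 e
      have := ih (N := ModuleCat.of R (QuotSMulTop a N)) h.2 hrs.2 (Nat.lt_of_succ_lt_succ hi)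
      rw [Subsingleton.elim e' 0]
      exact Ext.zero_comp M i h.1.smulShortComplex_shortExact.extClass _ _

/-- If `M` is annihilated by an `N`-regular sequence of length `n`, then `Ext M N n` is the module
of homomorphisms from `M` to the quotient of `N` by the sequence. -/
lemma RingTheory.Sequence.IsWeaklyRegular.nonempty_ext_linearEquiv {M N : ModuleCat.{u} R}
    {rs : List R} (h : IsWeaklyRegular N rs) (hrs : ∀ r ∈ rs, r ∈ Module.annihilator R M) :
    Nonempty (Ext M N rs.length ≃ₗ[R]
      (M →ₗ[R] N ⧸ (Ideal.ofList rs • ⊤ : Submodule R N))) := by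
  induction rs generalizing N with
  | nil =>
    refine ⟨(Ext.linearEquiv₀.trans ModuleCat.homLinearEquiv).trans
      (LinearEquiv.congrRight (Submodule.quotEquivOfEqBot _ ?_).symm)⟩
    rw [ofList_nil, Submodule.bot_smul]
  | cons a rs ih =>
    -- This degree is one below the length of the whole sequence; its vanishing makes the connecting
    -- map injective.
    have hvan : Subsingleton (Ext M (N.smulShortComplex a).X₂ rs.length) :=
      h.subsingleton_ext hrs (i := rs.length) (by simp)
    rw [isWeaklyRegular_cons_iff] at h
    rw [List.forall_mem_cons] at hrs
    obtain ⟨e⟩ := ih (N := ModuleCat.of R (QuotSMulTop a N)) h.2 hrs.2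
    have hS := h.1.smulShortComplex_shortExact
    let δ : Ext M (ModuleCat.of R (QuotSMulTop a N)) rs.length →ₗ[R] Ext M N (rs.length + 1) :=
      hS.extClass.postcompOfLinear R M rfl
    have hδ : Function.Bijective δ := by
      refine ⟨(injective_iff_map_eq_zero δ).mpr fun e he ↦ ?_, fun e ↦
        Ext.exists_comp_extClass_eq_of_mem_annihilator h.1 hrs.1 e⟩
      obtain ⟨e', he'⟩ := Ext.covariant_sequence_exact₃ M hS e rfl he
      rw [← he', Subsingleton.elim e' 0, Ext.zero_comp]
      rfl
    exact ⟨((LinearEquiv.ofBijective δ hδ).symm.trans e).trans (LinearEquiv.congrRight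
      (Submodule.quotOfListConsSMulTopEquivQuotSMulTopInner N a rs).symm)⟩

lemma IsGorensteinLocalRing.quotient_ofList [hR : IsGorensteinLocalRing R] {rs : List R}
    (h : IsWeaklyRegular R rs) (hrs : ∀ r ∈ rs, r ∈ IsLocalRing.maximalIdeal R) :
    IsGorensteinLocalRing (R ⧸ Ideal.ofList rs) := by
  generalize hn : rs.length = n
  induction n generalizing R with
  | zero =>
    rw [List.length_eq_zero_iff] at hn
    subst hn
    exact .of_ringEquiv ((RingEquiv.quotientBot R).symm.trans
      (Ideal.quotEquivOfEq ofList_nil.symm))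
  | succ n ih =>
    obtain _ | ⟨a, rs⟩ := rs
    · simp at hn
    rw [isWeaklyRegular_cons_iff] at h
    rw [List.forall_mem_cons] at hrs
    have hG := hR.quotient_span_singleton hrs.1 h.1
    have e : QuotSMulTop a R ≃ₗ[R] R ⧸ Ideal.span {a} := Submodule.quotEquivOfEq _ _ (by
      rw [← Submodule.ideal_span_singleton_smul, smul_eq_mul, mul_top])
    have := ih (rs := rs.map (Ideal.Quotient.mk (Ideal.span {a})))
      ((isWeaklyRegular_map_algebraMap_iff (S := R ⧸ Ideal.span {a}) (M := R ⧸ Ideal.span {a})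
        rs).mpr ((e.isWeaklyRegular_congr rs).mp h.2))
      (List.forall_mem_map.mpr fun r hr ↦ IsLocalRing.mk_mem_maximalIdeal_iff.mpr (hrs.2 r hr)) (by simpa using hn)
    exact .of_ringEquiv (((Ideal.quotEquivOfEq (map_ofList _ rs).symm).trans
      (DoubleQuot.quotQuotEquivQuotSup _ _)).trans (Ideal.quotEquivOfEq (ofList_cons a rs).symm))

/-- For `I = J + (y)`, the module of homomorphisms from `R ⧸ I` to `R ⧸ J` is isomorphic to `R ⧸ I`
if and only if the image of `y` in `R ⧸ J` belongs to a pair of exact zero divisors. -/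
lemma Ideal.nonempty_linearEquiv_iff_exists_isExactZeroDivisorPair {I J : Ideal R} {y : R}
    (hI : I = J ⊔ Ideal.span {y}) :
    Nonempty (((R ⧸ I) →ₗ[R] R ⧸ J) ≃ₗ[R] R ⧸ I) ↔
      ∃ z, IsExactZeroDivisorPair (Ideal.Quotient.mk J y) z := by
  have hmem (r : R) : r ∈ I ↔ Ideal.Quotient.mk J y ∣ Ideal.Quotient.mk J r := by
    rw [← Ideal.mem_span_singleton, ← Set.image_singleton, ← Ideal.map_span, ← Ideal.mem_comap,
      Ideal.comap_map_of_surjective' _ Ideal.Quotient.mk_surjective, Ideal.mk_ker, hI, sup_comm]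
  have hsmul (r : R) (a : R ⧸ J) : r • a = Ideal.Quotient.mk J r * a := Algebra.smul_def r a
  have hkill (a : R ⧸ J) (ha : Ideal.Quotient.mk J y * a = 0) :
      ∃ φ : (R ⧸ I) →ₗ[R] R ⧸ J, φ (I.mkQ 1) = a := by
    refine ⟨I.liftQ (LinearMap.toSpanSingleton R _ a) fun r hr ↦ ?_, ?_⟩
    · obtain ⟨c, hc⟩ := (hmem r).mp hr
      rw [LinearMap.mem_ker, LinearMap.toSpanSingleton_apply, hsmul, hc, mul_right_comm, ha,
        zero_mul]
    · exact (Submodule.liftQ_apply _ _ _).trans (one_smul _ _)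
  have hone (r : R) : I.mkQ r = r • I.mkQ 1 := by
    rw [← map_smul, smul_eq_mul, mul_one]
  have hmk (r : R) : I.mkQ r = 0 ↔ r ∈ I := by
    rw [Submodule.mkQ_apply, Submodule.Quotient.mk_eq_zero]
  have hext (φ ψ : (R ⧸ I) →ₗ[R] R ⧸ J) (h : φ (I.mkQ 1) = ψ (I.mkQ 1)) : φ = ψ := by
    refine LinearMap.ext fun t ↦ ?_
    obtain ⟨r, rfl⟩ := I.mkQ_surjective t
    rw [hone, map_smul, map_smul, h]
  have hy (φ : (R ⧸ I) →ₗ[R] R ⧸ J) : Ideal.Quotient.mk J y * φ (I.mkQ 1) = 0 := by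
    rw [← hsmul, ← map_smul, ← hone, (hmk y).mpr ((hmem y).mpr dvd_rfl), map_zero]
  constructor
  · rintro ⟨e⟩
    -- φ generates Hom(R/I, R/J) ≅ Ann(y) and has annihilator I, so z = φ(1) satisfies Ann(y) = (z)
    -- and Ann(z) = (y).
    let φ := e.symm (I.mkQ 1)
    have hφ (r : R) : r • φ = e.symm (I.mkQ r) := by rw [hone, map_smul]
    refine ⟨φ (I.mkQ 1), fun a ↦ ⟨⟨fun ha ↦ ?_, ?_⟩, ⟨fun ha ↦ ?_, ?_⟩⟩⟩
    · obtain ⟨ψ, rfl⟩ := hkill a ha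
      obtain ⟨r, hr⟩ := I.mkQ_surjective (e ψ)
      refine ⟨Ideal.Quotient.mk J r, ?_⟩
      rw [mul_comm, ← hsmul, ← LinearMap.smul_apply, hφ, hr, e.symm_apply_apply]
    · rintro ⟨t, rfl⟩
      rw [← mul_assoc, hy, zero_mul]
    · obtain ⟨r, rfl⟩ := Ideal.Quotient.mk_surjective a
      rw [← hmem, ← hmk, ← e.symm.map_eq_zero_iff, ← hφ]
      refine hext _ _ ?_
      rw [LinearMap.smul_apply, hsmul, mul_comm, ha, LinearMap.zero_apply]
    · rintro ⟨t, rfl⟩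
      rw [← mul_assoc, mul_comm (φ _), hy, zero_mul]
  · rintro ⟨z, hz⟩
    obtain ⟨φ, hφ⟩ := hkill z ((hz z).1.mpr dvd_rfl)
    have hker (r : R) : r • φ = 0 ↔ r ∈ I := by
      rw [hmem, ← (hz _).2, ← hφ, mul_comm, ← hsmul, ← LinearMap.smul_apply]
      exact ⟨fun h ↦ by rw [h, LinearMap.zero_apply], fun h ↦ hext _ _ h⟩
    have hK : I = LinearMap.ker (LinearMap.toSpanSingleton R _ φ) := by
      ext r
      rw [← hker, LinearMap.mem_ker, LinearMap.toSpanSingleton_apply]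
    refine ⟨(LinearEquiv.ofBijective (I.liftQ (LinearMap.toSpanSingleton R _ φ) hK.le)
      ⟨LinearMap.ker_eq_bot.mp (Submodule.ker_liftQ_eq_bot _ _ _ hK.ge), fun ψ ↦ ?_⟩).symm⟩
    obtain ⟨t, ht⟩ := (hz _).1.mp (hy ψ)
    obtain ⟨r, rfl⟩ := Ideal.Quotient.mk_surjective t
    refine ⟨I.mkQ r, (Submodule.liftQ_apply _ _ _).trans (hext _ _ ?_)⟩
    rw [LinearMap.toSpanSingleton_apply, LinearMap.smul_apply, hsmul, hφ, ht, mul_comm]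

end

theorem theorem3p6 {R : Type u} [CommRing R] [IsGorensteinLocalRing R]
    (n : ℕ) (x : Fin n → R) (hx : RingTheory.Sequence.IsRegular R (List.ofFn x))
    (y : R) (hy : y ∈ IsLocalRing.maximalIdeal R)
    (hheight : (Ideal.span (insert y (Set.range x))).height = n) :
    Nonempty
        (Abelian.Ext (ModuleCat.of R (R ⧸ Ideal.span (insert y (Set.range x))))
            (ModuleCat.of R R) n
          ≃ₗ[R] (R ⧸ Ideal.span (insert y (Set.range x)))) ↔
      (Ideal.span (insert y (Set.range x))).IsGorenstein := by
  set J := Ideal.ofList (List.ofFn x) with hJ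
  have hI : Ideal.span (insert y (Set.range x)) = J ⊔ Ideal.span {y} := by
    rw [Ideal.span_insert, sup_comm, hJ, Ideal.ofList]
    congr 2
    ext r
    simp [List.mem_ofFn]
  generalize Ideal.span (insert y (Set.range x)) = I at hI hheight ⊢
  have hJtop : (J • ⊤ : Ideal R) = J := by rw [smul_eq_mul, Ideal.mul_top]
  have hJmax : J ≤ IsLocalRing.maximalIdeal R :=
    IsLocalRing.le_maximalIdeal fun h ↦ hx.top_ne_smul (hJtop.trans h).symm
  have hmemJ (r : R) (hr : r ∈ List.ofFn x) : r ∈ J := Ideal.subset_span hr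
  have hS : IsGorensteinLocalRing (R ⧸ J) := .quotient_ofList hx.toIsWeaklyRegular
    fun r hr ↦ hJmax (hmemJ r hr)
  have hy' : Ideal.Quotient.mk J y ∈ IsLocalRing.maximalIdeal (R ⧸ J) :=
    IsLocalRing.mk_mem_maximalIdeal_iff.mpr hy
  let ε : ((R ⧸ J) ⧸ Ideal.span {Ideal.Quotient.mk J y}) ≃+* R ⧸ I :=
    ((Ideal.quotEquivOfEq (by rw [Ideal.map_span, Set.image_singleton])).trans
      (DoubleQuot.quotQuotEquivQuotSup J (Ideal.span {y}))).trans (Ideal.quotEquivOfEq hI.symm)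
  obtain ⟨e⟩ := hx.toIsWeaklyRegular.nonempty_ext_linearEquiv
    (M := ModuleCat.of R (R ⧸ I)) (N := ModuleCat.of R R) fun r hr ↦ by
      rw [Ideal.annihilator_quotient, hI]
      exact le_sup_left (α := Ideal R) (hmemJ r hr)
  rw [List.length_ofFn] at e
  let e' := e.trans (LinearEquiv.congrRight (Submodule.quotEquivOfEq _ _ hJtop))
  have hpair : Nonempty (Ext (ModuleCat.of R (R ⧸ I)) (ModuleCat.of R R) n ≃ₗ[R] (R ⧸ I)) ↔
      ∃ z, IsExactZeroDivisorPair (Ideal.Quotient.mk J y) z := by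
    rw [← Ideal.nonempty_linearEquiv_iff_exists_isExactZeroDivisorPair hI]
    exact ⟨fun ⟨f⟩ ↦ ⟨e'.symm.trans f⟩, fun ⟨f⟩ ↦ ⟨e'.trans f⟩⟩
  rw [hpair]
  constructor
  · rintro ⟨z, hz⟩
    have := hz.isGorensteinLocalRing hy'
    exact IsGorensteinLocalRing.of_ringEquiv ε
  · intro hG
    have hG' : IsGorensteinLocalRing (R ⧸ I) := hG
    have hA : IsGorensteinLocalRing ((R ⧸ J) ⧸ Ideal.span {Ideal.Quotient.mk J y}) :=
      .of_ringEquiv ε.symm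
    obtain ⟨z, hz, hyz⟩ : ∃ z : R ⧸ J, z ≠ 0 ∧ Ideal.Quotient.mk J y * z = 0 := by
      -- Otherwise x_1, ..., x_n, y would be a weakly regular sequence generating I, giving I height
      -- at least n + 1.
      by_contra! h
      have hyreg : IsSMulRegular (R ⧸ (J • ⊤ : Ideal R)) y := by
        rw [hJtop, isSMulRegular_iff_right_eq_zero_of_smul]
        intro z hz
        by_contra hz0
        exact h z hz0 ((Algebra.smul_def y z).symm.trans hz)
      have hreg : RingTheory.Sequence.IsWeaklyRegular R (List.ofFn x ++ [y]) := by
        rw [RingTheory.Sequence.isWeaklyRegular_append_iff,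
          RingTheory.Sequence.isWeaklyRegular_singleton_iff]
        exact ⟨hx.toIsWeaklyRegular, hyreg⟩
      have hle := hreg.length_le_height
      rw [Ideal.ofList_append, Ideal.ofList_singleton, ← hJ, ← hI, hheight] at hle
      simp only [List.length_append, List.length_ofFn, List.length_singleton, Nat.cast_le] at hle
      exact absurd hle (by lia)
    obtain ⟨d, hd⟩ := hS.exists_hasInjectiveDimensionLE_self
    exact IsLocalRing.exists_isExactZeroDivisorPair d hy' hz hyz
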